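/- Let $X$ be a completely regular Hausdorff space, and let $C(X)$ be the ring of continuous real-valued functions on $X$. Let $I(X)$ be the set of isolated points of $X$, let $X_L$ be the set of points of $X$ that have a compact neighborhood, and let $C_K(X)$ be the ideal of all $f\in C(X)$ whose support $\overline{\{x\in X: f(x)\neq 0\}}$ is compact. Call $X$ pseudo-discrete if every compact subset of $X$ has finite interior, and call an ideal $J$ of a commutative ring pure if for every $f\in J$ there is $g\in J$ with $f=fg$. Then $X$ is pseudo-discrete if and only if $I(X)=X_L$ and $C_K(X)$ is a pure ideal. -/

import Mathlib

open Topology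

namespace PseudoDiscrete

/-- A space is pseudo-discrete if each of its compact subsets has finite interior
(complete regularity is imposed separately, as a class on `X`). -/
def IsPseudoDiscrete (X : Type*) [TopologicalSpace X] : Prop :=
  ∀ K : Set X, IsCompact K → (interior K).Finite

/-- `I(X)`: the set of isolated points of `X`. -/
def isolatedPoints (X : Type*) [TopologicalSpace X] : Set X :=
  {x | IsOpen ({x} : Set X)}

/-- `X_L`: the set of points of `X` that have a compact neighborhood. -/
def locallyCompactPoints (X : Type*) [TopologicalSpace X] : Set X :=
  {x | ∃ K ∈ 𝓝 x, IsCompact K}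

/-- `C_K(X)`: the ideal of `C(X)` consisting of the functions with compact support, the support
being the closure of the cozero set. -/
def compactSupportIdeal (X : Type*) [TopologicalSpace X] : Ideal C(X, ℝ) where
  carrier := {f | HasCompactSupport f}
  add_mem' := fun {_ _} hf hg => HasCompactSupport.add hf hg
  zero_mem' := HasCompactSupport.zero
  smul_mem' := fun _ _ hf => HasCompactSupport.mul_left hf

/-- An ideal `I` is pure if for every `f ∈ I` there is `g ∈ I` with `f = f * g`. -/
def IsPureIdeal {R : Type*} [CommRing R] (I : Ideal R) : Prop :=
  ∀ f ∈ I, ∃ g ∈ I, f = f * g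

end PseudoDiscrete

namespace PseudoDiscrete

open Set

variable {X : Type*} [TopologicalSpace X]

/-! If compact sets have finite interior, each `f` in `C_K(X)` has a finite, hence clopen, cozero
set, whose indicator witnesses purity. Conversely, an infinite `interior K` contains a sequence of
isolated points, the cozero set of some `f` in `C_K(X)` (`exists_continuousMap_support_eq_range`).
Purity makes the closure of the sequence compact and made of isolated points, so finite. -/

theorem isOpen_singleton_of_mem_finite_open [T1Space X] {U : Set X} (hU : IsOpen U)
    (hfin : U.Finite) {x : X} (hx : x ∈ U) : IsOpen ({x} : Set X) := by
  have h : ({x} : Set X) = U \ (U \ {x}) := by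
    ext y
    simp only [mem_singleton_iff, mem_sdiff]
    constructor
    · rintro rfl
      exact ⟨hx, fun h => h.2 rfl⟩
    · rintro ⟨hy, h⟩
      by_contra hne
      exact h ⟨hy, hne⟩
  rw [h]
  exact hU.sdiff (hfin.subset sdiff_subset).isClosed

theorem isolatedPoints_subset_locallyCompactPoints :
    isolatedPoints X ⊆ locallyCompactPoints X := fun x hx =>
  ⟨{x}, IsOpen.mem_nhds hx rfl, isCompact_singleton⟩

theorem IsPseudoDiscrete.isolatedPoints_eq [T1Space X] (h : IsPseudoDiscrete X) :
    isolatedPoints X = locallyCompactPoints X := by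
  refine isolatedPoints_subset_locallyCompactPoints.antisymm ?_
  rintro x ⟨K, hK, hc⟩
  exact isOpen_singleton_of_mem_finite_open isOpen_interior (h K hc)
    (mem_interior_iff_mem_nhds.2 hK)

theorem IsPseudoDiscrete.finite_support (h : IsPseudoDiscrete X) {f : C(X, ℝ)}
    (hf : HasCompactSupport f) : (Function.support f).Finite :=
  (h _ hf).subset <| interior_maximal (subset_tsupport f) f.continuous.isOpen_support

theorem IsPseudoDiscrete.isPureIdeal_compactSupportIdeal [T2Space X] (h : IsPseudoDiscrete X) :
    IsPureIdeal (compactSupportIdeal X) := by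
  intro f hf
  have hfin := h.finite_support hf
  have hclopen : IsClopen (Function.support f) := ⟨hfin.isClosed, f.continuous.isOpen_support⟩
  refine ⟨⟨(Function.support f).indicator 1, continuous_one.indicator (by simp [hclopen.frontier_eq])⟩,
    ?_, ?_⟩
  · exact HasCompactSupport.of_support_subset_isCompact hfin.isCompact
      (by simp)
  · ext x
    by_cases hx : f x = 0
    · simp [hx]
    · simp [indicator_of_mem (show x ∈ Function.support f from hx)]

/-- Countably many isolated points, enumerated without repetition, are the cozero set of a
continuous function. -/
theorem exists_continuousMap_support_eq_range [T1Space X] {u : ℕ → X}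
    (hinj : Function.Injective u) (hu : ∀ n, IsOpen ({u n} : Set X)) :
    ∃ f : C(X, ℝ), Function.support f = range u := by
  classical
  -- Geometric weights give uniform convergence; each term is continuous because its singleton is
  -- clopen.
  let t : ℕ → X → ℝ := fun n => ({u n} : Set X).indicator fun _ => (1 / 2 : ℝ) ^ n
  have ht : Continuous fun x => ∑' n, t n x := by
    refine continuous_tsum (u := fun n => (1 / 2 : ℝ) ^ n)
      (fun n => continuous_const.indicator (by simp [IsClopen.frontier_eq ⟨isClosed_singleton, hu n⟩]))
      summable_geometric_two fun n x => ?_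
    refine (norm_indicator_le_norm_self _ _).trans ?_
    simp
  refine ⟨⟨_, ht⟩, ?_⟩
  ext x
  simp only [ContinuousMap.coe_mk, Function.mem_support, mem_range]
  constructor
  · intro hx
    by_contra! hne
    exact hx <| by simp [t, fun n => (hne n).symm]
  · rintro ⟨m, rfl⟩
    rw [tsum_eq_single m fun n hn => by simp [t, hinj.ne hn.symm]]
    simp [t]

theorem finite_of_isPureIdeal [T2Space X]
    (hI : locallyCompactPoints X ⊆ isolatedPoints X)
    (hpure : IsPureIdeal (compactSupportIdeal X)) {K : Set X} (hK : IsCompact K) :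
    (interior K).Finite := by
  by_contra hinf
  let u : ℕ → X := fun n => (Set.Infinite.natEmbedding _ hinf n : X)
  have hinj : Function.Injective u :=
    Subtype.val_injective.comp (Set.Infinite.natEmbedding _ hinf).injective
  have hmem (n) : u n ∈ interior K := (Set.Infinite.natEmbedding _ hinf n).2
  obtain ⟨f, hf⟩ := exists_continuousMap_support_eq_range hinj fun n =>
    hI ⟨K, mem_interior_iff_mem_nhds.1 (hmem n), hK⟩
  have hfK : HasCompactSupport f := by
    refine HasCompactSupport.of_support_subset_isCompact hK ?_
    rw [hf]
    rintro _ ⟨n, rfl⟩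
    exact interior_subset (hmem n)
  obtain ⟨g, hg, hfg⟩ := hpure f hfK
  -- From `f = f * g`, `g` is 1 where `f ≠ 0`, and by continuity on the closure.
  have hg1 : closure (range u) ⊆ {x | g x = 1} := by
    refine closure_minimal ?_ (isClosed_eq g.continuous continuous_const)
    rintro _ ⟨n, rfl⟩
    have hne : f (u n) ≠ 0 := by
      rw [← Function.mem_support, hf]
      exact mem_range_self n
    have := DFunLike.congr_fun hfg (u n)
    exact (mul_eq_left₀ hne).1 (by simpa using this.symm)
  have hsub : closure (range u) ⊆ Function.support g := fun x hx => by
    simp [show g x = 1 from hg1 hx]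
  have hcomp : IsCompact (closure (range u)) :=
    IsCompact.of_isClosed_subset hg isClosed_closure (hsub.trans (subset_tsupport g))
  -- Limit points of the sequence are isolated too: `tsupport g` is a compact neighborhood of each.
  obtain ⟨s, -, hs⟩ := hcomp.elim_nhds_subcover (fun x => {x}) fun x hx =>
    IsOpen.mem_nhds (hI ⟨tsupport g, Filter.mem_of_superset
      (g.continuous.isOpen_support.mem_nhds (hsub hx)) (subset_tsupport g), hg⟩) rfl
  have hfin : (range u).Finite := by
    refine s.finite_toSet.subset (subset_closure.trans (hs.trans ?_))
    simp
  exact infinite_range_of_injective hinj hfin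

end PseudoDiscrete

theorem corollary3p7 (X : Type*) [TopologicalSpace X] [T35Space X] :
    PseudoDiscrete.IsPseudoDiscrete X ↔
      PseudoDiscrete.isolatedPoints X = PseudoDiscrete.locallyCompactPoints X ∧
        PseudoDiscrete.IsPureIdeal (PseudoDiscrete.compactSupportIdeal X) :=
  ⟨fun h => ⟨h.isolatedPoints_eq, h.isPureIdeal_compactSupportIdeal⟩,
    fun ⟨hI, hpure⟩ _ hK => PseudoDiscrete.finite_of_isPureIdeal hI.superset hpure hK⟩
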